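/- Let $\mathbb{C}_+=\{z\in\mathbb{C}:\operatorname{Re} z>0\}$ and let $\alpha\ge -1$ be real. For $\alpha>-1$ let $\mathcal{B}^2_\alpha(\mathbb{C}_+)$ be the space of analytic functions $F:\mathbb{C}_+\to\mathbb{C}$ with $$\|F\|^2_{\mathcal{B}^2_\alpha}=\frac1\pi\int_{\mathbb{C}_+}(\operatorname{Re} z)^\alpha\,|F(z)|^2\,dA(z)<\infty,$$ where $A$ is area measure, and let $\mathcal{B}^2_{-1}(\mathbb{C}_+)=H^2(\mathbb{C}_+)$ be the Hardy space of analytic functions $F:\mathbb{C}_+\to\mathbb{C}$ with $$\|F\|^2_{\mathcal{B}^2_{-1}}=\sup_{x>0}\frac1{2\pi}\int_{-\infty}^{\infty}|F(x+iy)|^2\,dy<\infty.$$ Let $\varphi:\mathbb{C}_+\to\mathbb{C}_+$ be analytic. A sequence $z_n=x_n+iy_n$ in $\mathbb{C}_+$ is said to approach $\infty$ non-tangentially if $x_n\to\infty$ and $\sup_n|y_n|/x_n<\infty$. The map $\varphi$ is said to have a finite angular derivative at infinity if $|\varphi(z_n)|\to\infty$ whenever $z_n\to\infty$ non-tangentially,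 and there is a number $l\in\mathbb{C}$ such that $z_n/\varphi(z_n)\to l$ whenever $z_n\to\infty$ non-tangentially. Then the composition operator $C_\varphi F=F\circ\varphi$ is bounded on $\mathcal{B}^2_\alpha(\mathbb{C}_+)$ (that is, it maps $\mathcal{B}^2_\alpha(\mathbb{C}_+)$ into itself and there is $C<\infty$ with $\|C_\varphi F\|_{\mathcal{B}^2_\alpha}\le C\,\|F\|_{\mathcal{B}^2_\alpha}$ for all $F\in\mathcal{B}^2_\alpha(\mathbb{C}_+)$) if and only if $\varphi$ has a finite angular derivative at infinity. -/

import Mathlib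

open MeasureTheory Filter Set
open scoped NNReal ENNReal Topology

noncomputable section

/-- The open right complex half-plane `ℂ₊`. -/
def rightHalfPlane : Set ℂ := {z : ℂ | 0 < z.re}

/-- `φ` is a holomorphic self-map of `ℂ₊` (the values of `φ` off `ℂ₊` play no role). -/
structure IsAnalyticSelfMap (φ : ℂ → ℂ) : Prop where
  differentiableOn : DifferentiableOn ℂ φ rightHalfPlane
  mapsTo : MapsTo φ rightHalfPlane rightHalfPlane

/-- The square of the norm of the weighted Bergman space `B²_α(ℂ₊)`, with values in `[0, ∞]`:
for `α ≠ -1` the integral `∫_{ℂ₊} (Re z)^α |F z|² dz / π` against area measure, and for `α = -1`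
the Hardy norm `sup_{x > 0} ∫_ℝ |F (x + i y)|² dy / (2π)`.  It is used for `α ≥ -1` only. -/
def bergmanNormSq (α : ℝ) (F : ℂ → ℂ) : ℝ≥0∞ :=
  if α = -1 then
    ⨆ x : ℝ, ⨆ _ : 0 < x,
      (∫⁻ y : ℝ, ‖F ((x : ℂ) + (y : ℂ) * Complex.I)‖ₑ ^ 2) / ENNReal.ofReal (2 * Real.pi)
  else
    (∫⁻ z in rightHalfPlane, ENNReal.ofReal (z.re ^ α) * ‖F z‖ₑ ^ 2) / ENNReal.ofReal Real.pi

/-- The norm of `B²_α(ℂ₊)`, with values in `[0, ∞]`. -/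
def bergmanNorm (α : ℝ) (F : ℂ → ℂ) : ℝ≥0∞ :=
  bergmanNormSq α F ^ (1 / 2 : ℝ)

/-- The weighted Bergman space `B²_α(ℂ₊)`, `α ≥ -1`: functions analytic on `ℂ₊` of finite norm
(the values off `ℂ₊` play no role).  For `α = -1` this is the Hardy space `H²(ℂ₊)`. -/
def bergmanSpace (α : ℝ) : Set (ℂ → ℂ) :=
  {F | DifferentiableOn ℂ F rightHalfPlane ∧ bergmanNorm α F < ∞}

/-- The composition operator `C_φ F = F ∘ φ`. -/
def compOp (φ F : ℂ → ℂ) : ℂ → ℂ := F ∘ φ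

/-- `C_φ` is a bounded operator on `B²_α(ℂ₊)`: it maps the space into itself, and
`‖C_φ F‖ ≤ C ‖F‖` for some finite constant `C`. -/
def CompOpBounded (α : ℝ) (φ : ℂ → ℂ) : Prop :=
  (∀ F ∈ bergmanSpace α, compOp φ F ∈ bergmanSpace α) ∧
    ∃ C : ℝ≥0, ∀ F ∈ bergmanSpace α, bergmanNorm α (compOp φ F) ≤ (C : ℝ≥0∞) * bergmanNorm α F

/-- The sequence `z n = x n + i y n` in `ℂ₊` approaches infinity non-tangentially:
`x n → ∞` and `sup |y n| / x n < ∞`. -/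
def TendstoInftyNontangentially (z : ℕ → ℂ) : Prop :=
  (∀ n, z n ∈ rightHalfPlane) ∧ Tendsto (fun n => (z n).re) atTop atTop ∧
    BddAbove (range fun n => |(z n).im| / (z n).re)

/-- `φ` fixes infinity non-tangentially: `φ (z n) → ∞`, that is `|φ (z n)| → ∞`,
whenever `z n → ∞` non-tangentially. -/
def FixesInftyNontangentially (φ : ℂ → ℂ) : Prop :=
  ∀ z : ℕ → ℂ, TendstoInftyNontangentially z →
    Tendsto (fun n => φ (z n)) atTop (Bornology.cobounded ℂ)

/-- `φ` fixes infinity non-tangentially and the non-tangential limit of `z / φ z` at infinity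
exists and equals the complex number `l`. -/
def HasAngularDerivAtInfty (φ : ℂ → ℂ) (l : ℂ) : Prop :=
  FixesInftyNontangentially φ ∧
    ∀ z : ℕ → ℂ, TendstoInftyNontangentially z → Tendsto (fun n => z n / φ (z n)) atTop (𝓝 l)

/-- `φ` has a finite angular derivative at infinity. -/
def HasFiniteAngularDerivAtInfty (φ : ℂ → ℂ) : Prop :=
  ∃ l : ℂ, HasAngularDerivAtInfty φ l

end

/-! Both conditions are equivalent to a third: `c * Re z ≤ Re (φ z)` on the half-plane for some `c >
0`. By Julia–Carathéodory (`exists_tendsto_div_of_isAnalyticSelfMap`), the infimum of `Re (φ z) / Re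
z` is the non-tangential limit of `φ z / z` at infinity, so it is positive exactly when `z / φ z`
has a finite limit.

If the inequality holds, put `a = c x / 2`. Poisson's formula on the line `Re = a` bounds `π |F (φ
(x + iy))|²` by the integral of `Re (φ (x + iy) - a - it)⁻¹ |F (a + it)|²` over `t`. Now integrate
in `y` and interchange: for fixed `t`, the function `(φ (x + z) - a - it)⁻¹` has positive real part,
of size at most `2 / (c X)` at `z = X`, so letting `X → ∞` in Poisson's formula bounds its integral
over the imaginary axis by `2π / c`. Thus the `L²` norm of `F ∘ φ` on `Re = x` is controlled by that
of `F` on `Re = c x / 2` (`lineNormSq_comp_le`). Taking suprema or integrating against `x ^ α` gives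
boundedness.

Conversely, test `C_φ` on a power of `(z + conj a)⁻¹` with `a = φ w`, and evaluate at `w`. Bounded
point evaluation and the norm of the test function give `(Re w) ^ (α + 2) ≤ L (Re (φ w)) ^ (α + 2)`.
-/

/-! ### Poisson's formula on the half-plane -/

/-- Cauchy's theorem on the half-plane for the difference quotient of a bounded function. -/
lemma integral_imaginary_axis_dslope_eq_zero {G : ℂ → ℂ} {B X : ℝ} (hX : 0 < X)
    (hG : ∀ z : ℂ, 0 ≤ z.re → DifferentiableAt ℂ G z) (hB : ∀ z : ℂ, 0 ≤ z.re → ‖G z‖ ≤ B) :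
    Integrable (fun t : ℝ => dslope G X (t * Complex.I) / (t * Complex.I + X)) ∧
      ∫ t : ℝ, dslope G X (t * Complex.I) / (t * Complex.I + X) = 0 := by
  -- This is `(G z - G X) / (z² - X²)` with its singularity at `X` removed. It decays quadratically,
  -- so the far sides of a rectangle of size `R` contribute `O(1 / R)`.
  set h : ℂ → ℂ := fun z => dslope G X z / (z + X) with hh
  have hB0 : 0 ≤ B := (norm_nonneg _).trans (hB 0 (by simp))
  have hdd : ∀ z : ℂ, 0 ≤ z.re → DifferentiableAt ℂ (dslope G X) z := by
    intro z hz
    by_cases hzX : z = X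
    · have hopen : {z : ℂ | 0 < z.re} ∈ 𝓝 (X : ℂ) :=
        (isOpen_lt continuous_const Complex.continuous_re).mem_nhds (by simpa using hX)
      have := (Complex.differentiableOn_dslope (f := G) hopen).2
        (fun w hw => (hG w (le_of_lt hw)).differentiableWithinAt)
      rw [hzX]
      exact this.differentiableAt hopen
    · exact (differentiableAt_dslope_of_ne hzX).2 (hG z hz)
  have hne : ∀ z : ℂ, 0 ≤ z.re → z + X ≠ 0 := by
    intro z hz h0
    have := congrArg Complex.re h0
    simp at this
    linarith
  have hd : ∀ z : ℂ, 0 ≤ z.re → DifferentiableAt ℂ h z := fun z hz =>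
    (hdd z hz).div ((differentiableAt_id).add_const _) (hne z hz)
  have hval : ∀ z : ℂ, z ≠ X → h z = (G z - G X) / ((z - X) * (z + X)) := by
    intro z hz
    have hz' := sub_ne_zero.2 hz
    simp only [hh]
    rw [dslope_of_ne _ hz, slope_def_field]
    field_simp
  have hcont : Continuous fun t : ℝ => h (t * Complex.I) := by
    rw [continuous_iff_continuousAt]
    intro t
    have h1 : ContinuousAt h (t * Complex.I) := (hd _ (by simp)).continuousAt
    exact ContinuousAt.comp (f := fun t : ℝ => (t * Complex.I : ℂ)) h1 (by fun_prop)
  have hXsq : ∀ t : ℝ, ‖h (t * Complex.I)‖ ≤ 2 * B / (X ^ 2 + t ^ 2) := by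
    intro t
    have hpos : 0 < X ^ 2 + t ^ 2 := by positivity
    have hneX : (t * Complex.I : ℂ) ≠ X := by
      intro h0
      have := congrArg Complex.re h0
      simp at this
      linarith
    rw [hval _ hneX, norm_div]
    have h2 : ((t * Complex.I : ℂ) - X) * (t * Complex.I + X) = ((-(X ^ 2 + t ^ 2) : ℝ) : ℂ) := by
      push_cast
      ring_nf
      simp
    rw [h2, Complex.norm_real, norm_neg, Real.norm_of_nonneg hpos.le]
    gcongr
    calc ‖G (t * Complex.I) - G X‖ ≤ ‖G (t * Complex.I)‖ + ‖G X‖ := norm_sub_le _ _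
      _ ≤ B + B := add_le_add (hB _ (by simp)) (hB _ (by simpa using hX.le))
      _ = 2 * B := by ring
  have hint0 : Integrable fun t : ℝ => 2 * B / (X ^ 2 + t ^ 2) := by
    have := ((integrable_inv_one_add_sq.comp_div hX.ne').const_mul (2 * B / X ^ 2))
    refine this.congr (Eventually.of_forall fun t => ?_)
    field_simp
  have hint : Integrable fun t : ℝ => h (t * Complex.I) :=
    hint0.mono' hcont.aestronglyMeasurable (Eventually.of_forall hXsq)
  refine ⟨hint, ?_⟩
  have hbig : ∀ R : ℝ, 2 * X ≤ R → ∀ z : ℂ, 0 ≤ z.re → R ≤ ‖z‖ → ‖h z‖ ≤ 8 * B / R ^ 2 := by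
    intro R hR z hz hzR
    have hR0 : 0 < R := by linarith
    have hXn : ‖(X : ℂ)‖ = X := by rw [Complex.norm_real, Real.norm_of_nonneg hX.le]
    have h1 : R / 2 ≤ ‖z - X‖ := by
      have := norm_sub_norm_le z (X : ℂ)
      linarith
    have h2 : R / 2 ≤ ‖z + X‖ := by
      have := norm_sub_norm_le z (-X : ℂ)
      rw [norm_neg, sub_neg_eq_add] at this
      linarith
    have hzX : z ≠ X := by
      intro h0
      rw [h0, sub_self, norm_zero] at h1
      linarith
    rw [hval _ hzX, norm_div, norm_mul]
    calc ‖G z - G X‖ / (‖z - X‖ * ‖z + X‖) ≤ (B + B) / (R / 2 * (R / 2)) := by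
          gcongr
          exact (norm_sub_le _ _).trans (add_le_add (hB _ hz) (hB _ (by simpa using hX.le)))
      _ = 8 * B / R ^ 2 := by field_simp; ring
  have hrect : ∀ R : ℝ, 2 * X ≤ R → ‖∫ t in (-R)..R, h (t * Complex.I)‖ ≤ 32 * B / R := by
    intro R hR
    have hR0 : 0 < R := by linarith
    have key := Complex.integral_boundary_rect_eq_zero_of_differentiableOn h
      (⟨0, -R⟩ : ℂ) (⟨R, R⟩ : ℂ) (by
        intro z hz
        refine (hd z ?_).differentiableWithinAt
        have := hz.1
        simp only [mem_preimage, uIcc_of_le hR0.le] at this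
        exact this.1)
    simp only [Complex.ofReal_zero, zero_add] at key
    have hn : ∀ z : ℂ, |z.re| = R ∨ |z.im| = R → R ≤ ‖z‖ := by
      rintro z (h1 | h1)
      · exact h1 ▸ Complex.abs_re_le_norm z
      · exact h1 ▸ Complex.abs_im_le_norm z
    have e1 : ‖∫ x : ℝ in 0..R, h (x + (-R : ℝ) * Complex.I)‖ ≤ 8 * B / R ^ 2 * |R - 0| := by
      refine intervalIntegral.norm_integral_le_of_norm_le_const fun x hx => ?_
      rw [uIoc_of_le hR0.le] at hx
      exact hbig R hR _ (by simpa using hx.1.le) (hn _ (Or.inr (by simp [abs_of_pos hR0])))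
    have e2 : ‖∫ x : ℝ in 0..R, h (x + R * Complex.I)‖ ≤ 8 * B / R ^ 2 * |R - 0| := by
      refine intervalIntegral.norm_integral_le_of_norm_le_const fun x hx => ?_
      rw [uIoc_of_le hR0.le] at hx
      exact hbig R hR _ (by simpa using hx.1.le) (hn _ (Or.inr (by simp [abs_of_pos hR0])))
    have e3 : ‖∫ y : ℝ in (-R)..R, h (R + y * Complex.I)‖ ≤ 8 * B / R ^ 2 * |R - -R| := by
      refine intervalIntegral.norm_integral_le_of_norm_le_const fun x hx => ?_
      exact hbig R hR _ (by simpa using hR0.le) (hn _ (Or.inl (by simp [abs_of_pos hR0])))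
    have key2 : Complex.I • (∫ t in (-R)..R, h (t * Complex.I)) =
        (∫ x : ℝ in 0..R, h (x + (-R : ℝ) * Complex.I)) - (∫ x : ℝ in 0..R, h (x + R * Complex.I))
        + Complex.I • ∫ y : ℝ in (-R)..R, h (R + y * Complex.I) := (sub_eq_zero.1 key).symm
    have e4 : ‖Complex.I • (∫ t in (-R)..R, h (t * Complex.I))‖ =
      ‖∫ t in (-R)..R, h (t * Complex.I)‖ := by rw [norm_smul, Complex.norm_I, one_mul]
    rw [← e4, key2]
    refine (norm_add_le _ _).trans ?_
    rw [norm_smul, Complex.norm_I, one_mul]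
    refine (add_le_add ((norm_sub_le _ _).trans (add_le_add e1 e2)) e3).trans (le_of_eq ?_)
    rw [sub_zero, sub_neg_eq_add, abs_of_pos hR0, abs_of_pos (by linarith)]
    field_simp
    ring
  have t1 : Tendsto (fun R : ℝ => ∫ t in (-R)..R, h (t * Complex.I)) atTop
      (𝓝 (∫ t : ℝ, h (t * Complex.I))) :=
    intervalIntegral_tendsto_integral hint tendsto_neg_atTop_atBot tendsto_id
  have t2 : Tendsto (fun R : ℝ => ∫ t in (-R)..R, h (t * Complex.I)) atTop (𝓝 0) := by
    refine squeeze_zero_norm' ?_ (tendsto_const_nhds (x := 32 * B).div_atTop tendsto_id)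
    filter_upwards [eventually_ge_atTop (2 * X)] with R hR using hrect R hR
  exact tendsto_nhds_unique t1 t2

lemma integrable_div_sq_add_sq {X : ℝ} (hX : 0 < X) :
    Integrable fun t : ℝ => X / (X ^ 2 + t ^ 2) := by
  refine ((integrable_inv_one_add_sq.comp_div hX.ne').const_mul X⁻¹).congr
    (Eventually.of_forall fun t => ?_)
  field_simp

lemma integral_univ_div_sq_add_sq {X : ℝ} (hX : 0 < X) :
    ∫ t : ℝ, X / (X ^ 2 + t ^ 2) = Real.pi := by
  have : (fun t : ℝ => X / (X ^ 2 + t ^ 2)) = fun t : ℝ => X⁻¹ * (1 + (t / X) ^ 2)⁻¹ := by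
    funext t
    field_simp
  rw [this, integral_const_mul, Measure.integral_comp_div (fun t : ℝ => (1 + t ^ 2)⁻¹),
    integral_univ_inv_one_add_sq, abs_of_pos hX, smul_eq_mul]
  field_simp

/-- Poisson's formula at points of the real axis. -/
theorem integral_poisson_mul_eq {G : ℂ → ℂ} {B X : ℝ} (hX : 0 < X)
    (hG : ∀ z : ℂ, 0 ≤ z.re → DifferentiableAt ℂ G z) (hB : ∀ z : ℂ, 0 ≤ z.re → ‖G z‖ ≤ B) :
    Integrable (fun t : ℝ => ((X / (X ^ 2 + t ^ 2) : ℝ) : ℂ) * G (t * Complex.I)) ∧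
      ∫ t : ℝ, ((X / (X ^ 2 + t ^ 2) : ℝ) : ℂ) * G (t * Complex.I) = Real.pi * G X := by
  obtain ⟨h1, h2⟩ := integral_imaginary_axis_dslope_eq_zero hX hG hB
  have hP : Integrable fun t : ℝ => ((X / (X ^ 2 + t ^ 2) : ℝ) : ℂ) :=
    (integrable_div_sq_add_sq hX).ofReal
  have hI : ∫ t : ℝ, ((X / (X ^ 2 + t ^ 2) : ℝ) : ℂ) = Real.pi := by
    rw [integral_complex_ofReal, integral_univ_div_sq_add_sq hX]
  -- On the imaginary axis the Poisson kernel is `-X / (z² - X²)`, so subtracting the constant `G X`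
  -- from `G` leaves `-X` times a function of integral zero.
  have hdec : (fun t : ℝ => ((X / (X ^ 2 + t ^ 2) : ℝ) : ℂ) * G (t * Complex.I)) =
      fun t : ℝ => (-X : ℂ) * (dslope G X (t * Complex.I) / (t * Complex.I + X))
        + ((X / (X ^ 2 + t ^ 2) : ℝ) : ℂ) * G X := by
    funext t
    have hneX : (t * Complex.I : ℂ) ≠ X := by
      intro h0
      have := congrArg Complex.re h0
      simp at this
      linarith
    have hneX' : (t * Complex.I : ℂ) + X ≠ 0 := by
      intro h0
      have := congrArg Complex.re h0
      simp at this
      linarith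
    have hsub := sub_ne_zero.2 hneX
    have hpos : ((X ^ 2 + t ^ 2 : ℝ) : ℂ) ≠ 0 := by
      rw [Complex.ofReal_ne_zero]
      positivity
    rw [dslope_of_ne _ hneX, slope_def_field, div_div]
    have h3 : ((t * Complex.I : ℂ) - X) * (t * Complex.I + X) = -((X ^ 2 + t ^ 2 : ℝ) : ℂ) := by
      push_cast
      ring_nf
      simp
    rw [h3, Complex.ofReal_div]
    field_simp
    ring
  rw [hdec]
  refine ⟨(h1.const_mul _).add (hP.mul_const _), ?_⟩
  rw [integral_add (h1.const_mul _) (hP.mul_const _), integral_const_mul, h2,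
    integral_mul_const, hI]
  ring

lemma inv_re_eq_poisson (w : ℂ) (t : ℝ) :
    (w - t * Complex.I)⁻¹.re = w.re / (w.re ^ 2 + (t - w.im) ^ 2) := by
  rw [Complex.inv_re, Complex.normSq_apply]
  simp
  congr 1
  ring

/-- The square of the modulus of a bounded analytic function on the closed right half-plane
is dominated by the Poisson integral of its boundary values. -/
lemma pi_mul_enorm_sq_le_lintegral_poisson {G : ℂ → ℂ} {B : ℝ} {w : ℂ} (hw : 0 < w.re)
    (hG : ∀ z : ℂ, 0 ≤ z.re → DifferentiableAt ℂ G z) (hB : ∀ z : ℂ, 0 ≤ z.re → ‖G z‖ ≤ B) :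
    ENNReal.ofReal Real.pi * ‖G w‖ₑ ^ 2 ≤
      ∫⁻ t : ℝ, ENNReal.ofReal (w - t * Complex.I)⁻¹.re * ‖G (t * Complex.I)‖ₑ ^ 2 := by
  -- Since `G ^ 2` is itself analytic, Poisson's formula and the triangle inequality suffice; no
  -- convexity is needed.
  obtain ⟨-, h⟩ := integral_poisson_mul_eq (G := fun z => G (z + w.im * Complex.I) ^ 2)
    (B := B ^ 2) hw
    (fun z hz => ((hG _ (by simpa using hz)).comp z (by fun_prop)).pow 2)
    (fun z hz => by
      rw [norm_pow]
      have := hB (z + w.im * Complex.I) (by simpa using hz)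
      gcongr)
  rw [Complex.re_add_im] at h
  have h1 := enorm_integral_le_lintegral_enorm (μ := volume)
    (fun t : ℝ => ((w.re / (w.re ^ 2 + t ^ 2) : ℝ) : ℂ) * G (t * Complex.I + w.im * Complex.I) ^ 2)
  rw [h] at h1
  have h2 : ‖(Real.pi : ℂ) * G w ^ 2‖ₑ = ENNReal.ofReal Real.pi * ‖G w‖ₑ ^ 2 := by
    rw [enorm_mul, enorm_pow, ← ofReal_norm (Real.pi : ℂ), Complex.norm_real,
      Real.norm_of_nonneg Real.pi_pos.le]
  rw [h2] at h1
  refine h1.trans (le_of_eq (Eq.trans ?_ (lintegral_add_right_eq_self _ w.im)))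
  refine lintegral_congr fun t => ?_
  rw [inv_re_eq_poisson, enorm_mul, enorm_pow, ← ofReal_norm, Complex.norm_real,
    Real.norm_of_nonneg (by positivity)]
  congr 3
  · ring
  · push_cast
    ring_nf

/-- The integral over the imaginary axis of a nonnegative harmonic function is controlled by
its growth along the positive axis. -/
lemma lintegral_re_le_of_mul_re_le {f : ℂ → ℂ} {B K : ℝ}
    (hf : ∀ z : ℂ, 0 ≤ z.re → DifferentiableAt ℂ f z) (hB : ∀ z : ℂ, 0 ≤ z.re → ‖f z‖ ≤ B)
    (hre : ∀ z : ℂ, 0 ≤ z.re → 0 ≤ (f z).re) (hK : ∀ X : ℝ, 0 < X → X * (f X).re ≤ K) :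
    ∫⁻ y : ℝ, ENNReal.ofReal (f (y * Complex.I)).re ≤ ENNReal.ofReal (Real.pi * K) := by
  have hcont : Continuous fun t : ℝ => f (t * Complex.I) := by
    rw [continuous_iff_continuousAt]
    intro t
    have h1 : ContinuousAt f (t * Complex.I) := (hf _ (by simp)).continuousAt
    exact ContinuousAt.comp (f := fun t : ℝ => (t * Complex.I : ℂ)) h1 (by fun_prop)
  have hstep : ∀ X : ℝ, 0 < X →
      ∫⁻ y : ℝ, ENNReal.ofReal (X * (X / (X ^ 2 + y ^ 2) * (f (y * Complex.I)).re)) ≤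
        ENNReal.ofReal (Real.pi * K) := by
    intro X hX
    obtain ⟨hi, he⟩ := integral_poisson_mul_eq hX hf hB
    have hre' : ∀ y : ℝ, (((X / (X ^ 2 + y ^ 2) : ℝ) : ℂ) * f (y * Complex.I)).re =
      X / (X ^ 2 + y ^ 2) * (f (y * Complex.I)).re := fun y => Complex.re_ofReal_mul _ _
    have hi2 : Integrable fun y : ℝ => X / (X ^ 2 + y ^ 2) * (f (y * Complex.I)).re := by
      simpa only [hre', RCLike.re_eq_complex_re] using hi.re
    have he2 : ∫ y : ℝ, X / (X ^ 2 + y ^ 2) * (f (y * Complex.I)).re = Real.pi * (f X).re := by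
      have h3 := integral_re hi
      rw [he] at h3
      simpa only [RCLike.re_eq_complex_re, Complex.re_ofReal_mul] using h3
    rw [← ofReal_integral_eq_lintegral_ofReal (hi2.const_mul X)]
    · rw [integral_const_mul, he2]
      apply ENNReal.ofReal_le_ofReal
      have := mul_le_mul_of_nonneg_left (hK X hX) Real.pi_pos.le
      linarith
    · refine Eventually.of_forall fun y => ?_
      have := hre (y * Complex.I) (by simp)
      simp only [Pi.zero_apply]
      positivity
  -- `X` times the Poisson kernel tends to 1 as `X → ∞`; Fatou's lemma then transfers the bound
  -- `hstep`.
  have hlim : ∀ y : ℝ, Tendsto (fun n : ℕ => ENNReal.ofReal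
      (((n : ℝ) + 1) * (((n : ℝ) + 1) / (((n : ℝ) + 1) ^ 2 + y ^ 2) * (f (y * Complex.I)).re)))
      atTop (𝓝 (ENNReal.ofReal (f (y * Complex.I)).re)) := by
    intro y
    refine ENNReal.tendsto_ofReal ?_
    have h1 : Tendsto (fun n : ℕ => y ^ 2 / ((n : ℝ) + 1) ^ 2) atTop (𝓝 0) :=
      (tendsto_const_nhds).div_atTop ((tendsto_pow_atTop two_ne_zero).comp
        (tendsto_atTop_add_const_right _ _ tendsto_natCast_atTop_atTop))
    have h2 : Tendsto (fun n : ℕ => (1 + y ^ 2 / ((n : ℝ) + 1) ^ 2)⁻¹ * (f (y * Complex.I)).re)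
        atTop (𝓝 ((1 + 0)⁻¹ * (f (y * Complex.I)).re)) :=
      ((h1.const_add 1).inv₀ (by norm_num)).mul_const _
    rw [add_zero, inv_one, one_mul] at h2
    refine h2.congr fun n => ?_
    field_simp
  calc ∫⁻ y : ℝ, ENNReal.ofReal (f (y * Complex.I)).re
      = ∫⁻ y : ℝ, liminf (fun n : ℕ => ENNReal.ofReal (((n : ℝ) + 1) *
        (((n : ℝ) + 1) / (((n : ℝ) + 1) ^ 2 + y ^ 2) * (f (y * Complex.I)).re))) atTop :=
        lintegral_congr fun y => (hlim y).liminf_eq.symm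
    _ ≤ liminf (fun n : ℕ => ∫⁻ y : ℝ, ENNReal.ofReal (((n : ℝ) + 1) *
        (((n : ℝ) + 1) / (((n : ℝ) + 1) ^ 2 + y ^ 2) * (f (y * Complex.I)).re))) atTop := by
        refine lintegral_liminf_le fun n => ?_
        have hre_meas := Complex.measurable_re.comp hcont.measurable
        simp only [Function.comp_def] at hre_meas
        exact Measurable.ennreal_ofReal (by fun_prop)
    _ ≤ liminf (fun _ : ℕ => ENNReal.ofReal (Real.pi * K)) atTop :=
        liminf_le_liminf (Eventually.of_forall fun n => hstep _ (by positivity))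
    _ = ENNReal.ofReal (Real.pi * K) := liminf_const _

/-! ### Composition between vertical lines -/

/-- The square of the `L²` norm of `F` on the vertical line `Re z = x`. -/
noncomputable def lineNormSq (F : ℂ → ℂ) (x : ℝ) : ℝ≥0∞ :=
  ∫⁻ y : ℝ, ‖F ((x : ℂ) + (y : ℂ) * Complex.I)‖ₑ ^ 2

lemma isOpen_rightHalfPlane : IsOpen rightHalfPlane :=
  isOpen_lt continuous_const Complex.continuous_re

lemma continuous_comp_verticalLine {F : ℂ → ℂ} (hF : ContinuousOn F rightHalfPlane) {x : ℝ}
    (hx : 0 < x) : Continuous fun y : ℝ => F (x + y * Complex.I) :=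
  hF.comp_continuous (by fun_prop) fun y => by simpa [rightHalfPlane] using hx

/-- If `Re φ ≥ c Re` then composition with `φ` is bounded from the vertical line `Re = c x / 2`
to the vertical line `Re = x`. -/
theorem lineNormSq_comp_le {F φ : ℂ → ℂ} (hF : DifferentiableOn ℂ F rightHalfPlane)
    (hFb : ∀ δ : ℝ, 0 < δ → ∃ B : ℝ, ∀ z : ℂ, δ ≤ z.re → ‖F z‖ ≤ B)
    (hφ : DifferentiableOn ℂ φ rightHalfPlane) {c : ℝ} (hc : 0 < c)
    (hre : ∀ z ∈ rightHalfPlane, c * z.re ≤ (φ z).re) {x : ℝ} (hx : 0 < x) :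
    lineNormSq (F ∘ φ) x ≤ ENNReal.ofReal (2 / c) * lineNormSq F (c * x / 2) := by
  -- Half of the lower bound `c * x` for `Re φ` on the line: `F` is bounded and analytic on `Re ≥
  -- a`, and `Re φ - a` is still at least `a`.
  set a : ℝ := c * x / 2 with ha
  have ha0 : 0 < a := by positivity
  have hshift : ∀ z : ℂ, 0 ≤ z.re → c * (x + z.re) ≤ (φ (x + z)).re := fun z hz => by
    simpa using hre (x + z) (by simp only [rightHalfPlane, mem_ofPred_eq]; simp; linarith)
  have hpoint : ∀ y : ℝ, ENNReal.ofReal Real.pi * ‖(F ∘ φ) (x + y * Complex.I)‖ₑ ^ 2 ≤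
      ∫⁻ t : ℝ, ENNReal.ofReal (φ (x + y * Complex.I) - a - t * Complex.I)⁻¹.re *
        ‖F (a + t * Complex.I)‖ₑ ^ 2 := by
    intro y
    obtain ⟨B, hB⟩ := hFb a ha0
    have h1 := hshift (y * Complex.I) (by simp)
    have h := pi_mul_enorm_sq_le_lintegral_poisson (G := fun z => F (a + z)) (B := B)
      (w := φ (x + y * Complex.I) - a) (by
        simp at h1 ⊢
        have : 0 < c * x := by positivity
        linarith)
      (fun z hz => by
        have hz' : (a : ℂ) + z ∈ rightHalfPlane := by
          simp only [rightHalfPlane, mem_ofPred_eq]; simp; linarith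
        exact (hF.differentiableAt (isOpen_rightHalfPlane.mem_nhds hz')).comp z (by fun_prop))
      (fun z hz => hB _ (by simpa using hz))
    simpa using h
  have hinner : ∀ t : ℝ, ∫⁻ y : ℝ,
      ENNReal.ofReal (φ (x + y * Complex.I) - a - t * Complex.I)⁻¹.re ≤
        ENNReal.ofReal (Real.pi * (2 / c)) := by
    intro t
    have hlow : ∀ z : ℂ, 0 ≤ z.re →
        c * (x + z.re) / 2 ≤ (φ (x + z) - a - t * Complex.I).re := by
      intro z hz
      have := hshift z hz
      have h0 : 0 ≤ c * z.re := by positivity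
      simp
      linarith
    have hlowpos : ∀ z : ℂ, 0 ≤ z.re → 0 < c * (x + z.re) / 2 := fun z hz => by positivity
    refine lintegral_re_le_of_mul_re_le (f := fun z => (φ (x + z) - a - t * Complex.I)⁻¹)
      (B := a⁻¹) ?_ ?_ ?_ ?_
    · intro z hz
      have hz' : (x : ℂ) + z ∈ rightHalfPlane := by
        simp only [rightHalfPlane, mem_ofPred_eq]; simp; linarith
      refine DifferentiableAt.inv ?_ ?_
      · exact ((((hφ.differentiableAt (isOpen_rightHalfPlane.mem_nhds hz')).comp z
          (by fun_prop)).sub_const _).sub_const _)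
      · intro h0
        have h1 := hlow z hz
        rw [h0, Complex.zero_re] at h1
        linarith [hlowpos z hz]
    · intro z hz
      rw [norm_inv]
      refine inv_anti₀ ha0 ?_
      refine le_trans ?_ (Complex.re_le_norm _)
      refine le_trans ?_ (hlow z hz)
      have h0 : 0 ≤ c * z.re := by positivity
      rw [ha]
      linarith
    · intro z hz
      rw [Complex.inv_re]
      exact div_nonneg ((hlowpos z hz).le.trans (hlow z hz)) (Complex.normSq_nonneg _)
    · intro X hX
      have h1 := hlow X (by simpa using hX.le)
      have h2 := hlowpos X (by simpa using hX.le)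
      rw [Complex.ofReal_re] at h1 h2
      set w := φ (x + X) - a - t * Complex.I
      have hw : 0 < w.re := h2.trans_le h1
      have h3 : w⁻¹.re ≤ w.re⁻¹ := by
        rw [Complex.inv_re, Complex.normSq_apply, div_le_iff₀
          (add_pos_of_pos_of_nonneg (mul_pos hw hw) (mul_self_nonneg _))]
        have : 0 ≤ w.re⁻¹ * (w.im * w.im) := mul_nonneg (inv_nonneg.2 hw.le) (mul_self_nonneg _)
        rw [mul_add, ← mul_assoc, inv_mul_cancel₀ hw.ne']
        linarith
      have h4 : w.re⁻¹ ≤ (c * X / 2)⁻¹ := by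
        refine inv_anti₀ (by positivity) (le_trans ?_ h1)
        have : 0 < c * x := by positivity
        linarith
      calc X * w⁻¹.re ≤ X * (c * X / 2)⁻¹ := by gcongr; exact h3.trans h4
        _ = 2 / c := by field_simp
  have hFc : Continuous fun t : ℝ => F (a + t * Complex.I) :=
    continuous_comp_verticalLine hF.continuousOn ha0
  have hφc : Continuous fun y : ℝ => φ (x + y * Complex.I) :=
    continuous_comp_verticalLine hφ.continuousOn hx
  have hmeas : ∀ t : ℝ, Measurable fun y : ℝ =>
      ENNReal.ofReal (φ (x + y * Complex.I) - a - t * Complex.I)⁻¹.re := fun t => by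
    have := hφc.measurable
    exact (Complex.measurable_re.comp ((this.sub_const _).sub_const _).inv).ennreal_ofReal
  have hpi : ENNReal.ofReal Real.pi ≠ 0 := by simpa using Real.pi_pos
  have hmain : ENNReal.ofReal Real.pi * lineNormSq (F ∘ φ) x ≤
      ENNReal.ofReal Real.pi * (ENNReal.ofReal (2 / c) * lineNormSq F a) := by
    calc ENNReal.ofReal Real.pi * lineNormSq (F ∘ φ) x
        = ∫⁻ y : ℝ, ENNReal.ofReal Real.pi * ‖(F ∘ φ) (x + y * Complex.I)‖ₑ ^ 2 :=
          (lintegral_const_mul' _ _ ENNReal.ofReal_ne_top).symm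
      _ ≤ ∫⁻ y : ℝ, ∫⁻ t : ℝ,
          ENNReal.ofReal (φ (x + y * Complex.I) - a - t * Complex.I)⁻¹.re *
            ‖F (a + t * Complex.I)‖ₑ ^ 2 := lintegral_mono hpoint
      _ = ∫⁻ t : ℝ, ∫⁻ y : ℝ,
          ENNReal.ofReal (φ (x + y * Complex.I) - a - t * Complex.I)⁻¹.re *
            ‖F (a + t * Complex.I)‖ₑ ^ 2 := by
          refine lintegral_lintegral_swap (Measurable.aemeasurable ?_)
          have h1 : Measurable fun p : ℝ × ℝ => φ (x + p.1 * Complex.I) :=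
            (hφc.comp continuous_fst).measurable
          have h2 : Measurable fun p : ℝ × ℝ => F (a + p.2 * Complex.I) :=
            (hFc.comp continuous_snd).measurable
          have h3 : Measurable fun p : ℝ × ℝ =>
              (φ (x + p.1 * Complex.I) - a - p.2 * Complex.I)⁻¹ :=
            ((h1.sub_const _).sub (by fun_prop)).inv
          exact (Complex.measurable_re.comp h3).ennreal_ofReal.mul (h2.enorm.pow_const 2)
      _ = ∫⁻ t : ℝ, (∫⁻ y : ℝ,
          ENNReal.ofReal (φ (x + y * Complex.I) - a - t * Complex.I)⁻¹.re) *
            ‖F (a + t * Complex.I)‖ₑ ^ 2 :=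
          lintegral_congr fun t => lintegral_mul_const _ (hmeas t)
      _ ≤ ∫⁻ t : ℝ, ENNReal.ofReal (Real.pi * (2 / c)) * ‖F (a + t * Complex.I)‖ₑ ^ 2 :=
          lintegral_mono fun t => mul_le_mul_left (hinner t) _
      _ = ENNReal.ofReal Real.pi * (ENNReal.ofReal (2 / c) * lineNormSq F a) := by
          rw [lintegral_const_mul' _ _ ENNReal.ofReal_ne_top,
            ENNReal.ofReal_mul Real.pi_pos.le, mul_assoc]
          rfl
  exact (ENNReal.mul_le_mul_iff_right hpi ENNReal.ofReal_ne_top).1 hmain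

/-! ### Schwarz–Pick and Julia–Carathéodory -/

/-- The Schwarz–Pick inequality on the right half-plane. -/
theorem norm_mul_norm_le_of_mapsTo_rightHalfPlane {ψ : ℂ → ℂ}
    (hψ : DifferentiableOn ℂ ψ rightHalfPlane) (hm : MapsTo ψ rightHalfPlane rightHalfPlane)
    {z w : ℂ} (hz : z ∈ rightHalfPlane) (hw : w ∈ rightHalfPlane) :
    ‖ψ z - ψ w‖ * ‖z + starRingEnd ℂ w‖ ≤ ‖z - w‖ * ‖ψ z + starRingEnd ℂ (ψ w)‖ := by
  have hpos : ∀ {u v : ℂ}, u ∈ rightHalfPlane → v ∈ rightHalfPlane →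
      u + starRingEnd ℂ v ≠ 0 := by
    intro u v hu hv h0
    have := congrArg Complex.re h0
    simp at this
    have h1 : 0 < u.re := hu
    have h2 : 0 < v.re := hv
    linarith
  have hlt : ∀ {u v : ℂ}, u ∈ rightHalfPlane → v ∈ rightHalfPlane →
      ‖u - v‖ < ‖u + starRingEnd ℂ v‖ := by
    intro u v hu hv
    have h1 : 0 < u.re := hu
    have h2 : 0 < v.re := hv
    refine lt_of_pow_lt_pow_left₀ 2 (norm_nonneg _) ?_
    rw [← Complex.normSq_eq_norm_sq, ← Complex.normSq_eq_norm_sq, Complex.normSq_apply,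
      Complex.normSq_apply]
    simp
    nlinarith [mul_pos h1 h2]
  set b := ψ w
  have hb : b ∈ rightHalfPlane := hm hw
  -- The inverse of the Cayley map `z ↦ (z - w) / (z + conj w)`; it sends 0 to `w`.
  let γ : ℂ → ℂ := fun ζ => (w + starRingEnd ℂ w * ζ) / (1 - ζ)
  have hone : ∀ ζ ∈ Metric.ball (0 : ℂ) 1, 1 - ζ ≠ 0 := by
    intro ζ hζ h0
    rw [← sub_eq_zero.1 h0] at hζ
    simp at hζ
  have hγ : MapsTo γ (Metric.ball 0 1) rightHalfPlane := by
    intro ζ hζ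
    have h1 : 0 < Complex.normSq (1 - ζ) := Complex.normSq_pos.2 (hone ζ hζ)
    have h2 : Complex.normSq ζ < 1 := by
      rw [mem_ball_zero_iff] at hζ
      rw [Complex.normSq_eq_norm_sq]
      nlinarith [norm_nonneg ζ]
    have h3 : 0 < w.re := hw
    change 0 < (γ ζ).re
    have : (γ ζ).re = w.re * (1 - Complex.normSq ζ) / Complex.normSq (1 - ζ) := by
      simp only [γ, Complex.div_re, Complex.normSq_apply]
      simp
      field_simp
      ring
    rw [this]
    exact div_pos (mul_pos h3 (by linarith)) h1
  have hγd : DifferentiableOn ℂ γ (Metric.ball 0 1) := by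
    refine DifferentiableOn.div (by fun_prop) (by fun_prop) hone
  have hg := Complex.norm_le_norm_of_mapsTo_ball (R := 1)
    (f := fun ζ => (ψ (γ ζ) - b) / (ψ (γ ζ) + starRingEnd ℂ b))
    (z := (z - w) / (z + starRingEnd ℂ w))
    (by
      have h1 : DifferentiableOn ℂ (fun ζ => ψ (γ ζ)) (Metric.ball 0 1) := hψ.comp hγd hγ
      exact (h1.sub_const _).div (h1.add_const _) fun ζ hζ => hpos (hm (hγ hζ)) hb)
    (by
      intro ζ hζ
      rw [mem_closedBall_zero_iff, norm_div]
      exact div_le_one_of_le₀ (hlt (hm (hγ hζ)) hb).le (norm_nonneg _))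
    (by simp [γ, b])
    (by
      rw [norm_div, div_lt_one (norm_pos_iff.2 (hpos hz hw))]
      exact hlt hz hw)
  have hγz : γ ((z - w) / (z + starRingEnd ℂ w)) = z := by
    have h1 := hpos hz hw
    have h2 := hpos hw hw
    simp only [γ]
    have h3 : 1 - (z - w) / (z + starRingEnd ℂ w) = (w + starRingEnd ℂ w) / (z + starRingEnd ℂ w) := by
      field_simp
      ring
    rw [h3]
    field_simp
    ring
  simp only [hγz, norm_div] at hg
  rwa [div_le_div_iff₀ (norm_pos_iff.2 (hpos (hm hz) hb)) (norm_pos_iff.2 (hpos hz hw))] at hg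

/-- A Harnack type bound deduced from the Schwarz–Pick inequality. -/
lemma norm_sub_le_of_mapsTo_rightHalfPlane {ψ : ℂ → ℂ}
    (hψ : DifferentiableOn ℂ ψ rightHalfPlane) (hm : MapsTo ψ rightHalfPlane rightHalfPlane)
    {z w : ℂ} (hz : z ∈ rightHalfPlane) (hw : w ∈ rightHalfPlane) :
    ‖ψ z - ψ w‖ * (z.re * w.re) ≤ (ψ w).re * ‖z + starRingEnd ℂ w‖ ^ 2 := by
  have h := norm_mul_norm_le_of_mapsTo_rightHalfPlane hψ hm hz hw
  have hz0 : 0 < z.re := hz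
  have hw0 : 0 < w.re := hw
  have hb0 : 0 < (ψ w).re := hm hw
  set P := ‖z + starRingEnd ℂ w‖
  set D := ‖z - w‖
  set N := ‖ψ z - ψ w‖
  have hPD : P ^ 2 - D ^ 2 = 4 * (z.re * w.re) := by
    simp only [P, D]
    rw [← Complex.normSq_eq_norm_sq, ← Complex.normSq_eq_norm_sq, Complex.normSq_apply,
      Complex.normSq_apply]
    simp
    ring
  have hN0 : 0 ≤ N := norm_nonneg _
  have hP0 : 0 ≤ P := norm_nonneg _
  have hD0 : 0 ≤ D := norm_nonneg _
  have hDP : D ≤ P := by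
    refine (pow_le_pow_iff_left₀ hD0 hP0 two_ne_zero).1 ?_
    nlinarith [mul_pos hz0 hw0]
  have h2 : ‖ψ z + starRingEnd ℂ (ψ w)‖ ≤ N + 2 * (ψ w).re := by
    have : ψ z + starRingEnd ℂ (ψ w) = (ψ z - ψ w) + ((2 * (ψ w).re : ℝ) : ℂ) := by
      rw [← Complex.add_conj]
      ring
    rw [this]
    refine (norm_add_le _ _).trans ?_
    rw [Complex.norm_real, Real.norm_of_nonneg (by positivity)]
  -- Multiplying by `P + D` turns `P - D` into `P² - D²`, which is `4 * Re z * Re w`.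
  have h3 : N * (P - D) ≤ 2 * (ψ w).re * D := by
    have := mul_le_mul_of_nonneg_left h2 hD0
    linarith
  have h4 : N * (P - D) * (P + D) ≤ 2 * (ψ w).re * D * (P + D) := by gcongr
  have h5 : 2 * (ψ w).re * D * (P + D) ≤ 2 * (ψ w).re * P * (P + P) := by gcongr
  have h6 : N * (P - D) * (P + D) = 4 * (N * (z.re * w.re)) := by
    rw [mul_assoc, show (P - D) * (P + D) = 4 * (z.re * w.re) by rw [← hPD]; ring]
    ring
  have h7 : 2 * (ψ w).re * P * (P + P) = 4 * ((ψ w).re * P ^ 2) := by ring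
  linarith

/-- The **Julia–Carathéodory theorem** at infinity for self-maps of the right half-plane. -/
theorem exists_tendsto_div_of_isAnalyticSelfMap {φ : ℂ → ℂ} (hφ : IsAnalyticSelfMap φ) :
    ∃ c : ℝ, 0 ≤ c ∧ (∀ z ∈ rightHalfPlane, c * z.re ≤ (φ z).re) ∧
      (∀ c' : ℝ, (∀ z ∈ rightHalfPlane, c' * z.re ≤ (φ z).re) → c' ≤ c) ∧
      ∀ z : ℕ → ℂ, TendstoInftyNontangentially z →
        Tendsto (fun n => φ (z n) / z n) atTop (𝓝 c) := by
  set S : Set ℝ := (fun z => (φ z).re / z.re) '' rightHalfPlane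
  have hSne : S.Nonempty := ⟨_, mem_image_of_mem _ (show (1 : ℂ) ∈ rightHalfPlane by
    simp [rightHalfPlane])⟩
  have hSpos : ∀ s ∈ S, 0 ≤ s := by
    rintro _ ⟨z, hz, rfl⟩
    exact div_nonneg (le_of_lt (hφ.mapsTo hz)) (le_of_lt hz)
  have hSb : BddBelow S := ⟨0, fun s hs => hSpos s hs⟩
  have hlow : ∀ z ∈ rightHalfPlane, sInf S * z.re ≤ (φ z).re := fun z hz => by
    have hz0 : 0 < z.re := hz
    rw [← le_div_iff₀ hz0]
    exact csInf_le hSb (mem_image_of_mem _ hz)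
  refine ⟨sInf S, Real.sInf_nonneg hSpos, hlow, ?_, ?_⟩
  · intro c' hc'
    refine le_csInf hSne ?_
    rintro _ ⟨z, hz, rfl⟩
    have hz0 : 0 < z.re := hz
    exact (le_div_iff₀ hz0).2 (hc' z hz)
  · rintro z ⟨hz, hre, M, hM⟩
    have hM' : ∀ n, ‖z n‖ ≤ (1 + M) * (z n).re := by
      intro n
      have hz0 : 0 < (z n).re := hz n
      have h1 : |(z n).im| / (z n).re ≤ M := hM (mem_range_self n)
      rw [div_le_iff₀ hz0] at h1
      have h2 := Complex.norm_le_abs_re_add_abs_im (z n)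
      rw [abs_of_pos hz0] at h2
      linarith
    have hM0 : 0 ≤ M := le_trans (div_nonneg (abs_nonneg _) (le_of_lt (hz 0)))
      (hM (mem_range_self 0))
    have hnorm : Tendsto (fun n => ‖z n‖) atTop atTop :=
      tendsto_atTop_mono (fun n => Complex.re_le_norm _) hre
    set c := sInf S
    -- quantitative bound for `ψ = φ - (c - η) z`
    have hbound : ∀ η : ℝ, 0 < η → ∃ K : ℝ, 0 ≤ K ∧ ∀ n, K ≤ ‖z n‖ →
        ‖φ (z n) / z n - c‖ ≤ η * (10 * (1 + M) + 1) + K / ‖z n‖ := by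
      intro η hη
      -- At a near-minimiser `w` of `Re φ / Re`, the self-map `ψ` has real part at most `2 η Re w`,
      -- so the Harnack bound makes `ψ` of order `η |z|` in the sector.
      obtain ⟨_, ⟨w, hw, rfl⟩, hwη⟩ := exists_lt_of_csInf_lt hSne (lt_add_of_pos_right c hη)
      have hw0 : 0 < w.re := hw
      let ψ : ℂ → ℂ := fun ζ => φ ζ - ((c - η : ℝ) : ℂ) * ζ
      have hψre : ∀ ζ, (ψ ζ).re = (φ ζ).re - (c - η) * ζ.re := fun ζ => by
        simp only [ψ, Complex.sub_re, Complex.re_ofReal_mul]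
      have hψm : MapsTo ψ rightHalfPlane rightHalfPlane := fun ζ hζ => by
        have h1 := hlow ζ hζ
        have h2 : 0 < η * ζ.re := mul_pos hη hζ
        change 0 < (ψ ζ).re
        rw [hψre]
        linarith
      have hψd : DifferentiableOn ℂ ψ rightHalfPlane :=
        hφ.differentiableOn.sub (by fun_prop)
      have hψw : (ψ w).re ≤ 2 * η * w.re := by
        rw [div_lt_iff₀ hw0] at hwη
        rw [hψre]
        linarith
      -- The first entry gives `|z + conj w| ≤ 2 |z|`; the second absorbs the constant `ψ w`.
      refine ⟨max ‖w‖ ‖ψ w‖, by positivity, fun n hn => ?_⟩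
      have hz0 : 0 < (z n).re := hz n
      have hzn : 0 < ‖z n‖ := hz0.trans_le (Complex.re_le_norm _)
      have hzne : z n ≠ 0 := norm_pos_iff.1 hzn
      have h1 := norm_sub_le_of_mapsTo_rightHalfPlane hψd hψm (hz n) hw
      have h2 : ‖z n + starRingEnd ℂ w‖ ≤ 2 * ‖z n‖ := by
        refine (norm_add_le _ _).trans ?_
        rw [RCLike.norm_conj]
        linarith [(le_max_left ‖w‖ ‖ψ w‖).trans hn]
      have h3 : ‖ψ (z n) - ψ w‖ * (z n).re ≤ 8 * η * ‖z n‖ ^ 2 := by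
        have h4 : (ψ w).re * ‖z n + starRingEnd ℂ w‖ ^ 2 ≤
            2 * η * w.re * (2 * ‖z n‖) ^ 2 := by
          have : 0 ≤ (ψ w).re := le_of_lt (hψm hw)
          gcongr
        have h5 : ‖ψ (z n) - ψ w‖ * (z n).re * w.re ≤ 8 * η * ‖z n‖ ^ 2 * w.re := by
          linarith
        exact le_of_mul_le_mul_right h5 hw0
      have h6 : ‖ψ (z n) - ψ w‖ ≤ 8 * η * (1 + M) * ‖z n‖ := by
        refine le_of_mul_le_mul_right (h3.trans ?_) hz0
        have := mul_le_mul_of_nonneg_left (hM' n) (by positivity : 0 ≤ 8 * η * ‖z n‖)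
        linarith
      have h7 : φ (z n) / z n - c = ((ψ (z n) - ψ w) + ψ w) / z n - η := by
        simp only [ψ]
        push_cast
        field_simp
        ring
      rw [h7]
      refine (norm_sub_le _ _).trans ?_
      rw [Complex.norm_real, Real.norm_of_nonneg hη.le, norm_div]
      have h8 : ‖ψ (z n) - ψ w + ψ w‖ / ‖z n‖ ≤
          (8 * η * (1 + M) * ‖z n‖ + max ‖w‖ ‖ψ w‖) / ‖z n‖ := by
        gcongr
        exact (norm_add_le _ _).trans (add_le_add h6 (le_max_right _ _))
      rw [add_div, mul_div_cancel_right₀ _ hzn.ne'] at h8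
      have h9 : 0 ≤ η * (1 + M) := by positivity
      linarith
    rw [Metric.tendsto_atTop']
    intro ε hε
    have hden : 0 < 10 * (1 + M) + 1 := by positivity
    obtain ⟨K, hK0, hK⟩ := hbound (ε / 2 / (10 * (1 + M) + 1)) (by positivity)
    have h1 : Tendsto (fun n => K / ‖z n‖) atTop (𝓝 0) := tendsto_const_nhds.div_atTop hnorm
    obtain ⟨N, hN⟩ := eventually_atTop.1
      ((h1.eventually (gt_mem_nhds (half_pos hε))).and (hnorm.eventually_ge_atTop K))
    refine ⟨N, fun n hn => ?_⟩
    obtain ⟨h2, h3⟩ := hN n hn.le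
    rw [dist_eq_norm]
    have := hK n h3
    rw [div_mul_cancel₀ _ hden.ne'] at this
    linarith

/-- A finite angular derivative at infinity exists exactly when `Re φ` dominates a positive
multiple of `Re`. -/
theorem hasFiniteAngularDerivAtInfty_iff {φ : ℂ → ℂ} (hφ : IsAnalyticSelfMap φ) :
    HasFiniteAngularDerivAtInfty φ ↔
      ∃ c : ℝ, 0 < c ∧ ∀ z ∈ rightHalfPlane, c * z.re ≤ (φ z).re := by
  obtain ⟨c, hc0, hc, hmax, hlim⟩ := exists_tendsto_div_of_isAnalyticSelfMap hφ
  have hzne : ∀ {z : ℂ}, z ∈ rightHalfPlane → z ≠ 0 := by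
    rintro z hz rfl
    simp [rightHalfPlane] at hz
  constructor
  · rintro ⟨l, -, hl⟩
    have hseq : TendstoInftyNontangentially fun n : ℕ => ((n : ℂ) + 1) := by
      refine ⟨fun n => ?_, ?_, 0, ?_⟩
      · simp only [rightHalfPlane, mem_ofPred_eq]
        simp
        positivity
      · simpa using tendsto_atTop_add_const_right _ (1 : ℝ) tendsto_natCast_atTop_atTop
      · rintro _ ⟨n, rfl⟩
        simp
    refine ⟨c, lt_of_le_of_ne hc0 ?_, hc⟩
    rintro rfl
    -- If `c = 0`, the product of `z / φ z` and `φ z / z`, which is constantly 1, would tend to `l *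
    -- 0`.
    have h1 := (hl _ hseq).mul (hlim _ hseq)
    rw [Complex.ofReal_zero, mul_zero] at h1
    have h2 : Tendsto (fun _ : ℕ => (1 : ℂ)) atTop (𝓝 0) := by
      refine h1.congr fun n => ?_
      have h3 := hzne (hseq.1 n)
      have h4 := hzne (hφ.mapsTo (hseq.1 n))
      field_simp
    exact one_ne_zero (tendsto_nhds_unique tendsto_const_nhds h2)
  · rintro ⟨c', hc', h⟩
    have hcpos : 0 < c := hc'.trans_le (hmax c' h)
    refine ⟨(c : ℂ)⁻¹, fun z hz => ?_, fun z hz => ?_⟩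
    · rw [← tendsto_norm_atTop_iff_cobounded]
      refine tendsto_atTop_mono (fun n => ?_) (hz.2.1.const_mul_atTop hcpos)
      exact (hc _ (hz.1 n)).trans (Complex.re_le_norm _)
    · refine ((hlim z hz).inv₀ (by exact_mod_cast hcpos.ne')).congr fun n => ?_
      rw [inv_div]

/-! ### Norms through vertical lines, and point evaluations -/

/-- Fubini's theorem on vertical strips. -/
lemma setLIntegral_re_preimage_eq {T : Set ℝ} {h : ℂ → ℝ≥0∞}
    (hh : AEMeasurable h (volume.restrict (Complex.re ⁻¹' T))) :
    ∫⁻ z in Complex.re ⁻¹' T, h z = ∫⁻ x in T, ∫⁻ y : ℝ, h ((x : ℂ) + (y : ℂ) * Complex.I) := by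
  have mp := Complex.volume_preserving_equiv_real_prod.symm
  have hset : Complex.measurableEquivRealProd.symm ⁻¹' (Complex.re ⁻¹' T) = T ×ˢ univ := by
    ext p
    simp [Complex.measurableEquivRealProd]
  have hemb := Complex.measurableEquivRealProd.symm.measurableEmbedding
  have hrest := mp.restrict_preimage_emb hemb (Complex.re ⁻¹' T)
  rw [hset] at hrest
  rw [← mp.setLIntegral_comp_preimage_emb hemb, hset, Measure.volume_eq_prod, setLIntegral_prod]
  · refine lintegral_congr fun x => ?_
    rw [Measure.restrict_univ]
    refine lintegral_congr fun y => ?_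
    rw [← Complex.mk_eq_add_mul_I]
    rfl
  · exact hh.comp_quasiMeasurePreserving hrest.quasiMeasurePreserving

lemma aemeasurable_enorm_sq_of_continuousOn {F : ℂ → ℂ} {U : Set ℂ} (hU : MeasurableSet U)
    (hF : ContinuousOn F U) : AEMeasurable (fun z => ‖F z‖ₑ ^ 2) (volume.restrict U) :=
  (hF.aemeasurable hU).enorm.pow_const 2

lemma bergmanNormSq_neg_one (F : ℂ → ℂ) :
    bergmanNormSq (-1) F = ⨆ x : ℝ, ⨆ _ : 0 < x, lineNormSq F x / ENNReal.ofReal (2 * Real.pi) := by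
  simp only [bergmanNormSq, if_true, lineNormSq]

lemma bergmanNormSq_of_ne {α : ℝ} (hα : α ≠ -1) {F : ℂ → ℂ}
    (hF : ContinuousOn F rightHalfPlane) :
    bergmanNormSq α F =
      (∫⁻ x in Ioi (0 : ℝ), ENNReal.ofReal (x ^ α) * lineNormSq F x) / ENNReal.ofReal Real.pi := by
  have hset : rightHalfPlane = Complex.re ⁻¹' Ioi 0 := rfl
  rw [bergmanNormSq, if_neg hα, hset, setLIntegral_re_preimage_eq]
  · congr 1
    refine lintegral_congr fun x => ?_
    simp only [lineNormSq]
    rw [← lintegral_const_mul' _ _ ENNReal.ofReal_ne_top]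
    refine lintegral_congr fun y => ?_
    simp
  · refine AEMeasurable.mul ?_
      (aemeasurable_enorm_sq_of_continuousOn isOpen_rightHalfPlane.measurableSet hF)
    exact ((Complex.measurable_re.pow_const α).ennreal_ofReal).aemeasurable

/-- The mean value property of the analytic function `F ^ 2`, followed by the triangle inequality.
The angles run over `(-π, π)` to match polar coordinates. -/
lemma two_pi_mul_enorm_sq_le_lintegral_circle {F : ℂ → ℂ} {U : Set ℂ}
    (hF : DifferentiableOn ℂ F U) {w : ℂ} {ρ : ℝ} (hρ : 0 < ρ)
    (hsub : Metric.closedBall w ρ ⊆ U) :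
    ENNReal.ofReal (2 * Real.pi) * ‖F w‖ₑ ^ 2 ≤
      ∫⁻ θ in Ioo (-Real.pi) Real.pi, ‖F (circleMap w ρ θ)‖ₑ ^ 2 := by
  have hpi := Real.pi_pos
  have hd : DiffContOnCl ℂ (fun z => F z ^ 2) (Metric.ball w |ρ|) := by
    rw [abs_of_pos hρ]
    refine DifferentiableOn.diffContOnCl ?_
    rw [closure_ball _ hρ.ne']
    exact (hF.mono hsub).pow 2
  have h := hd.circleAverage
  rw [Real.circleAverage_def] at h
  have hper : ∫ θ in (0 : ℝ)..2 * Real.pi, F (circleMap w ρ θ) ^ 2 =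
      ∫ θ in (-Real.pi)..Real.pi, F (circleMap w ρ θ) ^ 2 := by
    have hp : Function.Periodic (fun θ => F (circleMap w ρ θ) ^ 2) (2 * Real.pi) :=
      fun θ => by simp only [periodic_circleMap w ρ θ]
    have := hp.intervalIntegral_add_eq 0 (-Real.pi)
    rw [zero_add, show -Real.pi + 2 * Real.pi = Real.pi by ring] at this
    exact this
  rw [hper, intervalIntegral.integral_of_le (by linarith), integral_Ioc_eq_integral_Ioo] at h
  have h2 : ∫ θ in Ioo (-Real.pi) Real.pi, F (circleMap w ρ θ) ^ 2 =
      ((2 * Real.pi : ℝ) : ℂ) * F w ^ 2 := by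
    rw [← h, ← Complex.real_smul, smul_smul, mul_inv_cancel₀ (by positivity), one_smul]
  have h3 := enorm_integral_le_lintegral_enorm (μ := volume.restrict (Ioo (-Real.pi) Real.pi))
    (fun θ => F (circleMap w ρ θ) ^ 2)
  rw [h2, enorm_mul, enorm_pow, ← ofReal_norm, Complex.norm_real,
    Real.norm_of_nonneg (by positivity)] at h3
  simpa only [enorm_pow] using h3

/-- The sub-mean value property of `|F|²` on discs. -/
theorem pi_sq_mul_enorm_sq_le_setLIntegral_ball {F : ℂ → ℂ} {U : Set ℂ}
    (hF : DifferentiableOn ℂ F U) {w : ℂ} {r : ℝ} (hr : 0 < r) (hsub : Metric.ball w r ⊆ U) :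
    ENNReal.ofReal (Real.pi * r ^ 2) * ‖F w‖ₑ ^ 2 ≤ ∫⁻ z in Metric.ball w r, ‖F z‖ₑ ^ 2 := by
  set g : ℂ → ℝ≥0∞ := (Metric.ball w r).indicator fun z => ‖F z‖ₑ ^ 2 with hg
  have hpi := Real.pi_pos
  set R : Set (ℝ × ℝ) := Ioo 0 r ×ˢ Ioo (-Real.pi) Real.pi
  have hRsub : R ⊆ polarCoord.target := by
    rintro ⟨ρ, θ⟩ ⟨h1, h2⟩
    exact ⟨h1.1, h2⟩
  have hsymm : ∀ p : ℝ × ℝ, Complex.polarCoord.symm p + w = circleMap w p.1 p.2 := by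
    intro p
    rw [Complex.polarCoord_symm_apply, circleMap, Complex.exp_mul_I]
    push_cast
    ring
  have hball : ∀ p ∈ R, circleMap w p.1 p.2 ∈ Metric.ball w r := by
    rintro ⟨ρ, θ⟩ ⟨h1, h2⟩
    have h1' : 0 < ρ ∧ ρ < r := h1
    rw [Metric.mem_ball, dist_eq_norm]
    simp [circleMap, abs_of_pos h1'.1, h1'.2]
  have hFc : ContinuousOn (fun p : ℝ × ℝ => F (circleMap w p.1 p.2)) R := by
    refine (hF.continuousOn.mono hsub).comp ?_ hball
    simp only [circleMap]
    fun_prop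
  have hRm : MeasurableSet R := measurableSet_Ioo.prod measurableSet_Ioo
  calc ENNReal.ofReal (Real.pi * r ^ 2) * ‖F w‖ₑ ^ 2
      = ∫⁻ ρ in Ioo 0 r, ENNReal.ofReal ρ * (ENNReal.ofReal (2 * Real.pi) * ‖F w‖ₑ ^ 2) := by
        have h0 : ∫⁻ ρ in Ioo 0 r, ENNReal.ofReal ρ = ENNReal.ofReal (r ^ 2 / 2) := by
          rw [← ofReal_integral_eq_lintegral_ofReal, ← integral_Ioc_eq_integral_Ioo,
            ← intervalIntegral.integral_of_le hr.le, integral_id]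
          · simp
          · exact (continuous_id.integrableOn_Icc).mono_set Ioo_subset_Icc_self
          · exact (ae_restrict_iff' measurableSet_Ioo).2
              (Eventually.of_forall fun x hx => hx.1.le)
        rw [lintegral_mul_const _ (by fun_prop), h0, ← mul_assoc,
          ← ENNReal.ofReal_mul (by positivity)]
        congr 2
        ring
    _ ≤ ∫⁻ ρ in Ioo 0 r, ∫⁻ θ in Ioo (-Real.pi) Real.pi,
          ENNReal.ofReal ρ * ‖F (circleMap w ρ θ)‖ₑ ^ 2 := by
        refine setLIntegral_mono' measurableSet_Ioo fun ρ hρ => ?_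
        rw [lintegral_const_mul' _ _ ENNReal.ofReal_ne_top]
        gcongr
        exact two_pi_mul_enorm_sq_le_lintegral_circle hF hρ.1
          ((Metric.closedBall_subset_ball hρ.2).trans hsub)
    _ = ∫⁻ p in R, ENNReal.ofReal p.1 * ‖F (circleMap w p.1 p.2)‖ₑ ^ 2 := by
        rw [Measure.volume_eq_prod, setLIntegral_prod]
        refine AEMeasurable.mul ?_ ((hFc.aemeasurable hRm).enorm.pow_const 2)
        exact (measurable_fst.ennreal_ofReal).aemeasurable
    _ = ∫⁻ p in R, ENNReal.ofReal p.1 • g (Complex.polarCoord.symm p + w) := by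
        refine setLIntegral_congr_fun hRm fun p hp => ?_
        simp only [hsymm, hg, indicator_of_mem (hball p hp), smul_eq_mul]
    _ ≤ ∫⁻ p in polarCoord.target, ENNReal.ofReal p.1 • g (Complex.polarCoord.symm p + w) :=
        lintegral_mono_set hRsub
    _ = ∫⁻ z, g (z + w) := Complex.lintegral_comp_polarCoord_symm fun z => g (z + w)
    _ = ∫⁻ z, g z := lintegral_add_right_eq_self _ w
    _ = ∫⁻ z in Metric.ball w r, ‖F z‖ₑ ^ 2 := lintegral_indicator measurableSet_ball _

/-- Point evaluations are controlled by the `L²` norms on nearby vertical lines. -/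
lemma enorm_sq_le_setLIntegral_lineNormSq {F : ℂ → ℂ} (hF : DifferentiableOn ℂ F rightHalfPlane)
    {w : ℂ} (hw : w ∈ rightHalfPlane) :
    ENNReal.ofReal (Real.pi * (w.re / 2) ^ 2) * ‖F w‖ₑ ^ 2 ≤
      ∫⁻ x in Ioo (w.re / 2) (3 * w.re / 2), lineNormSq F x := by
  have hw0 : 0 < w.re := hw
  have hball : Metric.ball w (w.re / 2) ⊆ Complex.re ⁻¹' Ioo (w.re / 2) (3 * w.re / 2) := by
    intro z hz
    rw [Metric.mem_ball, dist_eq_norm] at hz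
    have h1 := (Complex.abs_re_le_norm (z - w)).trans_lt hz
    rw [Complex.sub_re, abs_lt] at h1
    constructor <;> linarith
  have hstrip : Complex.re ⁻¹' Ioo (w.re / 2) (3 * w.re / 2) ⊆ rightHalfPlane := fun z hz =>
    (half_pos hw0).trans hz.1
  refine (pi_sq_mul_enorm_sq_le_setLIntegral_ball hF (half_pos hw0)
    (hball.trans hstrip)).trans ((lintegral_mono_set hball).trans (le_of_eq ?_))
  exact setLIntegral_re_preimage_eq (aemeasurable_enorm_sq_of_continuousOn
    (Complex.measurable_re measurableSet_Ioo) (hF.continuousOn.mono hstrip))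

/-- The weight is monotone, in a direction depending on the sign of `α`, so the smaller endpoint
value serves in both cases. -/
lemma exists_mul_rpow_le_rpow (α : ℝ) : ∃ m : ℝ, 0 < m ∧ ∀ s : ℝ, 0 < s →
    ∀ x ∈ Ioo (s / 2) (3 * s / 2), m * s ^ α ≤ x ^ α := by
  refine ⟨min ((1 / 2) ^ α) ((3 / 2) ^ α), by positivity, fun s hs x hx => ?_⟩
  have hx0 : 0 < x := (half_pos hs).trans hx.1
  rcases le_total 0 α with h | h
  · calc min ((1 / 2) ^ α) ((3 / 2) ^ α) * s ^ α ≤ (1 / 2) ^ α * s ^ α := by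
          gcongr
          exact min_le_left _ _
      _ = (1 / 2 * s) ^ α := (Real.mul_rpow (by norm_num) hs.le).symm
      _ ≤ x ^ α := Real.rpow_le_rpow (by positivity) (by linarith [hx.1]) h
  · calc min ((1 / 2) ^ α) ((3 / 2) ^ α) * s ^ α ≤ (3 / 2) ^ α * s ^ α := by
          gcongr
          exact min_le_right _ _
      _ = (3 / 2 * s) ^ α := (Real.mul_rpow (by norm_num) hs.le).symm
      _ ≤ x ^ α := Real.rpow_le_rpow_of_nonpos hx0 (by linarith [hx.2]) h

/-- Point evaluations are bounded on `B²_α(ℂ₊)`. -/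
theorem exists_enorm_sq_le_bergmanNormSq (α : ℝ) : ∃ K : ℝ, 0 < K ∧ ∀ F : ℂ → ℂ,
    DifferentiableOn ℂ F rightHalfPlane → ∀ w ∈ rightHalfPlane,
      ENNReal.ofReal (w.re ^ (α + 2)) * ‖F w‖ₑ ^ 2 ≤ ENNReal.ofReal K * bergmanNormSq α F := by
  have hpi := Real.pi_pos
  by_cases hα : α = -1
  · subst hα
    -- With `s = Re w`, the strip has width `s`, so `(π s² / 4) |F w|² ≤ 2π s ‖F‖²`.
    refine ⟨8, by norm_num, fun F hF w hw => ?_⟩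
    have hw0 : 0 < w.re := hw
    have h1 := enorm_sq_le_setLIntegral_lineNormSq hF hw
    have h2 : ∀ x ∈ Ioo (w.re / 2) (3 * w.re / 2),
        lineNormSq F x ≤ ENNReal.ofReal (2 * Real.pi) * bergmanNormSq (-1) F := by
      intro x hx
      have h3 : lineNormSq F x / ENNReal.ofReal (2 * Real.pi) ≤ bergmanNormSq (-1) F := by
        rw [bergmanNormSq_neg_one]
        exact le_iSup₂_of_le x ((half_pos hw0).trans hx.1) le_rfl
      rw [mul_comm]
      exact (ENNReal.div_le_iff (by simpa using hpi) ENNReal.ofReal_ne_top).1 h3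
    have h4 := h1.trans (setLIntegral_mono' measurableSet_Ioo h2)
    rw [setLIntegral_const, Real.volume_Ioo] at h4
    refine (ENNReal.mul_le_mul_iff_right (a := ENNReal.ofReal (Real.pi * w.re / 4))
      (by simpa using by positivity) ENNReal.ofReal_ne_top).1 ?_
    rw [← mul_assoc, ← mul_assoc, ← ENNReal.ofReal_mul (by positivity),
      ← ENNReal.ofReal_mul (by positivity)]
    refine le_trans (le_of_eq ?_) (h4.trans (le_of_eq ?_))
    · congr 2
      rw [show (-1 : ℝ) + 2 = 1 by norm_num, Real.rpow_one]
      ring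
    · rw [mul_right_comm, ← ENNReal.ofReal_mul (by positivity)]
      congr 2
      ring
  · obtain ⟨m, hm, hmle⟩ := exists_mul_rpow_le_rpow α
    refine ⟨4 / m, by positivity, fun F hF w hw => ?_⟩
    have hw0 : 0 < w.re := hw
    have h1 := enorm_sq_le_setLIntegral_lineNormSq hF hw
    have h2 : ENNReal.ofReal (m * w.re ^ α) *
        ∫⁻ x in Ioo (w.re / 2) (3 * w.re / 2), lineNormSq F x ≤
          ENNReal.ofReal Real.pi * bergmanNormSq α F := by
      rw [bergmanNormSq_of_ne hα hF.continuousOn, ENNReal.mul_div_cancel (by simpa using hpi)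
        ENNReal.ofReal_ne_top, ← lintegral_const_mul' _ _ ENNReal.ofReal_ne_top]
      refine (setLIntegral_mono' measurableSet_Ioo fun x hx => ?_).trans
        (lintegral_mono_set (fun x hx => (half_pos hw0).trans hx.1))
      gcongr
      exact hmle _ hw0 x hx
    refine (ENNReal.mul_le_mul_iff_right (a := ENNReal.ofReal (Real.pi * m / 4))
      (by simpa using by positivity) ENNReal.ofReal_ne_top).1 ?_
    refine le_trans (le_of_eq ?_) ((mul_le_mul_right h1 (ENNReal.ofReal (m * w.re ^ α))).trans
      (h2.trans (le_of_eq ?_)))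
    · rw [← mul_assoc, ← mul_assoc, ← ENNReal.ofReal_mul (by positivity),
        ← ENNReal.ofReal_mul (by positivity), Real.rpow_add hw0, Real.rpow_two]
      congr 2
      ring
    · rw [← mul_assoc, ← ENNReal.ofReal_mul (by positivity)]
      congr 2
      field_simp

/-! ### Sufficiency: boundedness from `Re φ ≥ c Re` -/

lemma setLIntegral_Ioi_comp_mul_left (h : ℝ → ℝ≥0∞) {b : ℝ} (hb : 0 < b) :
    ENNReal.ofReal b * ∫⁻ x in Ioi (0 : ℝ), h (b * x) = ∫⁻ x in Ioi (0 : ℝ), h x := by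
  have hemb : MeasurableEmbedding (fun x : ℝ => b * x) :=
    (Homeomorph.mulLeft₀ b hb.ne').measurableEmbedding
  have hmap := Real.smul_map_volume_mul_left hb.ne'
  rw [abs_of_pos hb] at hmap
  rw [← lintegral_indicator measurableSet_Ioi, ← lintegral_indicator measurableSet_Ioi]
  conv_rhs => rw [← hmap, lintegral_smul_measure, hemb.lintegral_map]
  rw [smul_eq_mul]
  congr 1
  refine lintegral_congr fun x => ?_
  simp only [indicator_apply, mem_Ioi, mul_pos_iff_of_pos_left hb]

lemma bergmanNorm_lt_top_iff {α : ℝ} {F : ℂ → ℂ} :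
    bergmanNorm α F < ∞ ↔ bergmanNormSq α F < ∞ :=
  ENNReal.rpow_lt_top_iff_of_pos (by norm_num)

lemma exists_norm_le_of_mem_bergmanSpace {α : ℝ} (hα : -1 ≤ α) {F : ℂ → ℂ}
    (hF : F ∈ bergmanSpace α) {δ : ℝ} (hδ : 0 < δ) :
    ∃ B : ℝ, ∀ z : ℂ, δ ≤ z.re → ‖F z‖ ≤ B := by
  obtain ⟨K, -, hK⟩ := exists_enorm_sq_le_bergmanNormSq α
  set T := ENNReal.ofReal K * bergmanNormSq α F / ENNReal.ofReal (δ ^ (α + 2))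
  have hδp : 0 < δ ^ (α + 2) := by positivity
  have hT : T ≠ ∞ := ENNReal.div_ne_top
    (ENNReal.mul_ne_top ENNReal.ofReal_ne_top (bergmanNorm_lt_top_iff.1 hF.2).ne)
    (by simpa using hδp)
  refine ⟨√T.toReal, fun z hz => ?_⟩
  have h1 : ‖F z‖ₑ ^ 2 ≤ T := by
    rw [ENNReal.le_div_iff_mul_le (Or.inl (by simpa using hδp)) (Or.inl ENNReal.ofReal_ne_top),
      mul_comm]
    refine le_trans ?_ (hK F hF.1 z (hδ.trans_le hz))
    gcongr
    linarith
  have h2 := ENNReal.toReal_mono hT h1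
  rw [ENNReal.toReal_pow, toReal_enorm] at h2
  exact Real.le_sqrt_of_sq_le h2

/-- One factor `2 / c` comes from the comparison of lines, and `(2 / c) ^ (α + 1)` from rescaling
the measure `x ^ α dx`. For `α = -1` only the first remains. -/
theorem bergmanNormSq_comp_le {α : ℝ} (hα : -1 ≤ α) {F φ : ℂ → ℂ} (hF : F ∈ bergmanSpace α)
    (hφ : IsAnalyticSelfMap φ) {c : ℝ} (hc : 0 < c)
    (hre : ∀ z ∈ rightHalfPlane, c * z.re ≤ (φ z).re) :
    bergmanNormSq α (F ∘ φ) ≤ ENNReal.ofReal ((2 / c) ^ (α + 2)) * bergmanNormSq α F := by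
  have hline : ∀ x : ℝ, 0 < x →
      lineNormSq (F ∘ φ) x ≤ ENNReal.ofReal (2 / c) * lineNormSq F (c / 2 * x) := fun x hx => by
    have := lineNormSq_comp_le hF.1 (fun δ hδ => exists_norm_le_of_mem_bergmanSpace hα hF hδ)
      hφ.differentiableOn hc hre hx
    rwa [show c * x / 2 = c / 2 * x by ring] at this
  by_cases h : α = -1
  · subst h
    rw [show (-1 : ℝ) + 2 = 1 by norm_num, Real.rpow_one, bergmanNormSq_neg_one,
      bergmanNormSq_neg_one]
    refine iSup₂_le fun x hx => ?_
    refine (ENNReal.div_le_div_right (hline x hx) _).trans ?_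
    rw [mul_div_assoc]
    gcongr
    exact le_iSup₂_of_le (c / 2 * x) (by positivity) le_rfl
  · rw [bergmanNormSq_of_ne h hF.1.continuousOn, bergmanNormSq_of_ne h
      (hF.1.comp hφ.differentiableOn hφ.mapsTo).continuousOn, ← mul_div_assoc]
    refine ENNReal.div_le_div_right ?_ _
    have hb : 0 < c / 2 := by positivity
    rw [← setLIntegral_Ioi_comp_mul_left (fun x => ENNReal.ofReal (x ^ α) * lineNormSq F x) hb,
      ← mul_assoc,
      ← lintegral_const_mul' _ _ (ENNReal.mul_ne_top ENNReal.ofReal_ne_top ENNReal.ofReal_ne_top)]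
    refine setLIntegral_mono' measurableSet_Ioi fun x hx => ?_
    have hx0 : 0 < x := hx
    calc ENNReal.ofReal (x ^ α) * lineNormSq (F ∘ φ) x
        ≤ ENNReal.ofReal (x ^ α) * (ENNReal.ofReal (2 / c) * lineNormSq F (c / 2 * x)) := by
          gcongr
          exact hline x hx
      _ = ENNReal.ofReal ((2 / c) ^ (α + 2)) * ENNReal.ofReal (c / 2) *
          (ENNReal.ofReal ((c / 2 * x) ^ α) * lineNormSq F (c / 2 * x)) := by
          rw [← mul_assoc, ← mul_assoc, ← ENNReal.ofReal_mul (by positivity),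
            ← ENNReal.ofReal_mul (by positivity), ← ENNReal.ofReal_mul (by positivity)]
          congr 2
          rw [Real.mul_rpow hb.le hx0.le, Real.rpow_add (by positivity), Real.rpow_two]
          have h1 : (2 / c) ^ α * (c / 2) ^ α = 1 := by
            rw [← Real.mul_rpow (by positivity) hb.le, show 2 / c * (c / 2) = 1 by field_simp,
              Real.one_rpow]
          calc x ^ α * (2 / c) = x ^ α * (2 / c) * ((2 / c) ^ α * (c / 2) ^ α) := by
                rw [h1, mul_one]
            _ = _ := by
                field_simp

theorem compOpBounded_of_le_re {α : ℝ} (hα : -1 ≤ α) {φ : ℂ → ℂ}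
    (hφ : IsAnalyticSelfMap φ) {c : ℝ} (hc : 0 < c)
    (hre : ∀ z ∈ rightHalfPlane, c * z.re ≤ (φ z).re) : CompOpBounded α φ := by
  refine ⟨fun F hF => ⟨hF.1.comp hφ.differentiableOn hφ.mapsTo, ?_⟩,
    (((2 / c) ^ (α + 2)).toNNReal) ^ (1 / 2 : ℝ), fun F hF => ?_⟩
  · exact bergmanNorm_lt_top_iff.2 ((bergmanNormSq_comp_le hα hF hφ hc hre).trans_lt
      (ENNReal.mul_lt_top ENNReal.ofReal_lt_top (bergmanNorm_lt_top_iff.1 hF.2)))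
  · rw [ENNReal.coe_rpow_of_nonneg _ (by norm_num), bergmanNorm, bergmanNorm,
      ← ENNReal.mul_rpow_of_nonneg _ _ (by norm_num)]
    exact ENNReal.rpow_le_rpow (bergmanNormSq_comp_le hα hF hφ hc hre) (by norm_num)

/-! ### Necessity: testing on kernels -/

/-- The functions `z ↦ (z + conj a)⁻ᵏ`, of the type of reproducing kernels. -/
noncomputable def kernelPow (k : ℕ) (a : ℂ) : ℂ → ℂ := fun z => ((z + starRingEnd ℂ a) ^ k)⁻¹

lemma differentiableOn_kernelPow (k : ℕ) {a : ℂ} (ha : a ∈ rightHalfPlane) :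
    DifferentiableOn ℂ (kernelPow k a) rightHalfPlane := by
  refine DifferentiableOn.inv (by fun_prop) fun z hz => pow_ne_zero _ fun h0 => ?_
  have h1 := congrArg Complex.re h0
  have h2 : 0 < z.re := hz
  have h3 : 0 < a.re := ha
  simp at h1
  linarith

/-- With `u = x + Re a`, one of the `j + 1` factors `|z + conj a|⁻²` is kept and integrates to `π /
u`; the other `j` are bounded by `u⁻²`. -/
lemma lineNormSq_kernelPow_le (j : ℕ) {a : ℂ} (ha : a ∈ rightHalfPlane) {x : ℝ} (hx : 0 < x) :
    lineNormSq (kernelPow (j + 1) a) x ≤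
      ENNReal.ofReal (Real.pi * ((x + a.re) ^ (2 * j + 1))⁻¹) := by
  have ha0 : 0 < a.re := ha
  set u := x + a.re with hu
  have hu0 : 0 < u := by positivity
  have hpt : ∀ y : ℝ, ‖kernelPow (j + 1) a (x + y * Complex.I)‖ₑ ^ 2 ≤
      ENNReal.ofReal ((u ^ (2 * j + 1))⁻¹ * (u / (u ^ 2 + (y + -a.im) ^ 2))) := by
    intro y
    rw [← ofReal_norm, ← ENNReal.ofReal_pow (norm_nonneg _)]
    apply ENNReal.ofReal_le_ofReal
    have hn : ‖(x : ℂ) + y * Complex.I + starRingEnd ℂ a‖ ^ 2 = u ^ 2 + (y + -a.im) ^ 2 := by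
      rw [← Complex.normSq_eq_norm_sq, Complex.normSq_apply]
      simp [hu]
      ring
    rw [kernelPow, norm_inv, norm_pow, inv_pow, ← pow_mul, mul_comm (j + 1) 2, pow_mul, hn, pow_succ,
      mul_inv]
    have h1 : (u ^ 2 + (y + -a.im) ^ 2)⁻¹ = u⁻¹ * (u / (u ^ 2 + (y + -a.im) ^ 2)) := by
      field_simp
    rw [h1, ← mul_assoc]
    refine mul_le_mul_of_nonneg_right ?_ (by positivity)
    rw [← mul_inv, pow_succ u (2 * j), pow_mul u 2]
    gcongr
    nlinarith [sq_nonneg (y + -a.im)]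
  refine (lintegral_mono hpt).trans (le_of_eq ?_)
  rw [lintegral_add_right_eq_self
    (fun y => ENNReal.ofReal ((u ^ (2 * j + 1))⁻¹ * (u / (u ^ 2 + y ^ 2)))),
    ← ofReal_integral_eq_lintegral_ofReal ((integrable_div_sq_add_sq hu0).const_mul _)
      (Eventually.of_forall fun y => by simp only [Pi.zero_apply]; positivity),
    integral_const_mul, integral_univ_div_sq_add_sq hu0, mul_comm]

/-- Split at `s`, replacing `x + s` by `s` below and by `x` above: `α > -1` gives convergence at 0,
and `α < 2 j` at infinity. -/
lemma setLIntegral_rpow_mul_le {α s : ℝ} (hα : -1 < α) (hs : 0 < s) {j : ℕ} (hj : α < 2 * j) :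
    ∫⁻ x in Ioi (0 : ℝ), ENNReal.ofReal (x ^ α * ((x + s) ^ (2 * j + 1))⁻¹) ≤
      ENNReal.ofReal (((α + 1)⁻¹ + (2 * j - α)⁻¹) * s ^ (α - 2 * j)) := by
  have h1 : 0 < α + 1 := by linarith
  have h2 : 0 < 2 * (j : ℝ) - α := by linarith
  have hpow : ∀ x : ℝ, 0 < x → (x ^ (2 * j + 1))⁻¹ = x ^ (-(2 * (j : ℝ) + 1)) := fun x hx => by
    rw [Real.rpow_neg hx.le, ← Real.rpow_natCast]
    push_cast
    rfl
  rw [← Ioc_union_Ioi_eq_Ioi hs.le]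
  refine (lintegral_union_le _ _ _).trans ?_
  rw [add_mul, ENNReal.ofReal_add (by positivity) (by positivity)]
  refine add_le_add ?_ ?_
  · have hint : IntegrableOn (fun x : ℝ => x ^ α * s ^ (-(2 * (j : ℝ) + 1))) (Ioc 0 s) := by
      rw [← intervalIntegrable_iff_integrableOn_Ioc_of_le hs.le]
      exact (intervalIntegral.intervalIntegrable_rpow' hα).mul_const _
    calc ∫⁻ x in Ioc 0 s, ENNReal.ofReal (x ^ α * ((x + s) ^ (2 * j + 1))⁻¹)
        ≤ ∫⁻ x in Ioc 0 s, ENNReal.ofReal (x ^ α * s ^ (-(2 * (j : ℝ) + 1))) := by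
          refine setLIntegral_mono' measurableSet_Ioc fun x hx => ?_
          have hx0 : 0 < x := hx.1
          rw [← hpow s hs]
          gcongr
          linarith
      _ = ENNReal.ofReal ((α + 1)⁻¹ * s ^ (α - 2 * j)) := by
          rw [← ofReal_integral_eq_lintegral_ofReal hint, ← intervalIntegral.integral_of_le hs.le,
            intervalIntegral.integral_mul_const, integral_rpow (Or.inl hα),
            Real.zero_rpow h1.ne', sub_zero, div_mul_eq_mul_div, ← Real.rpow_add hs,
            div_eq_inv_mul]
          · congr 3
            ring
          · refine (ae_restrict_iff' measurableSet_Ioc).2 (Eventually.of_forall fun x hx => ?_)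
            have hx0 : 0 < x := hx.1
            simp only [Pi.zero_apply]
            positivity
  · have hlt : α - (2 * j + 1) < -1 := by linarith
    calc ∫⁻ x in Ioi s, ENNReal.ofReal (x ^ α * ((x + s) ^ (2 * j + 1))⁻¹)
        ≤ ∫⁻ x in Ioi s, ENNReal.ofReal (x ^ (α - (2 * j + 1))) := by
          refine setLIntegral_mono' measurableSet_Ioi fun x hx => ?_
          have hx0 : 0 < x := hs.trans hx
          rw [sub_eq_add_neg, Real.rpow_add hx0, ← hpow x hx0]
          gcongr
          linarith
      _ = ENNReal.ofReal ((2 * j - α)⁻¹ * s ^ (α - 2 * j)) := by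
          rw [← ofReal_integral_eq_lintegral_ofReal (integrableOn_Ioi_rpow_of_lt hlt hs),
            integral_Ioi_rpow_of_lt hlt hs]
          · have h3 : α - (2 * j + 1) + 1 = -(2 * j - α) := by ring
            rw [h3, neg_div_neg_eq, div_eq_inv_mul]
            congr 3
            ring
          · refine (ae_restrict_iff' measurableSet_Ioi).2 (Eventually.of_forall fun x hx => ?_)
            have hx0 : 0 < x := hs.trans hx
            simp only [Pi.zero_apply]
            positivity

lemma exists_bergmanNormSq_kernelPow_le {α : ℝ} (hα : -1 ≤ α) :
    ∃ (j : ℕ) (K : ℝ), 0 < K ∧ ∀ a ∈ rightHalfPlane,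
      bergmanNormSq α (kernelPow (j + 1) a) ≤ ENNReal.ofReal (K * a.re ^ (α - 2 * j)) := by
  have hpi := Real.pi_pos
  by_cases h : α = -1
  · subst h
    refine ⟨0, 1 / 2, by norm_num, fun a ha => ?_⟩
    have ha0 : 0 < a.re := ha
    rw [bergmanNormSq_neg_one]
    refine iSup₂_le fun x hx => ?_
    rw [ENNReal.div_le_iff (by simpa using hpi) ENNReal.ofReal_ne_top,
      ← ENNReal.ofReal_mul (by positivity)]
    refine (lineNormSq_kernelPow_le 0 ha hx).trans (ENNReal.ofReal_le_ofReal ?_)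
    have h1 : a.re ^ ((-1 : ℝ) - 2 * ((0 : ℕ) : ℝ)) = a.re⁻¹ := by
      rw [← Real.rpow_neg_one]
      norm_num
    rw [h1]
    have h2 : (x + a.re)⁻¹ ≤ a.re⁻¹ := inv_anti₀ ha0 (by linarith)
    have h3 := mul_le_mul_of_nonneg_left h2 hpi.le
    simp only [mul_zero, zero_add, pow_one]
    linarith
  · have hα' : -1 < α := lt_of_le_of_ne hα (Ne.symm h)
    obtain ⟨j, hj⟩ := exists_nat_gt α
    have hj2 : α < 2 * (j : ℝ) := by
      have : (0 : ℝ) ≤ j := Nat.cast_nonneg j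
      linarith
    have h1 : 0 < α + 1 := by linarith
    have h2 : 0 < 2 * (j : ℝ) - α := by linarith
    refine ⟨j, (α + 1)⁻¹ + (2 * j - α)⁻¹, by positivity, fun a ha => ?_⟩
    have ha0 : 0 < a.re := ha
    rw [bergmanNormSq_of_ne h (differentiableOn_kernelPow _ ha).continuousOn,
      ENNReal.div_le_iff (by simpa using hpi) ENNReal.ofReal_ne_top]
    calc ∫⁻ x in Ioi (0 : ℝ), ENNReal.ofReal (x ^ α) * lineNormSq (kernelPow (j + 1) a) x
        ≤ ∫⁻ x in Ioi (0 : ℝ), ENNReal.ofReal (x ^ α * ((x + a.re) ^ (2 * j + 1))⁻¹) *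
            ENNReal.ofReal Real.pi := by
          refine setLIntegral_mono' measurableSet_Ioi fun x hx => ?_
          have hx0 : 0 < x := hx
          refine (mul_le_mul_right (lineNormSq_kernelPow_le j ha hx0) _).trans (le_of_eq ?_)
          rw [← ENNReal.ofReal_mul (by positivity), ← ENNReal.ofReal_mul (by positivity)]
          congr 1
          ring
      _ = (∫⁻ x in Ioi (0 : ℝ), ENNReal.ofReal (x ^ α * ((x + a.re) ^ (2 * j + 1))⁻¹)) *
            ENNReal.ofReal Real.pi := lintegral_mul_const' _ _ ENNReal.ofReal_ne_top
      _ ≤ _ := by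
          gcongr
          exact setLIntegral_rpow_mul_le hα' ha0 hj2

theorem exists_le_re_of_compOpBounded {α : ℝ} (hα : -1 ≤ α) {φ : ℂ → ℂ}
    (hφ : IsAnalyticSelfMap φ) (hb : CompOpBounded α φ) :
    ∃ c : ℝ, 0 < c ∧ ∀ z ∈ rightHalfPlane, c * z.re ≤ (φ z).re := by
  obtain ⟨hmaps, C, hC⟩ := hb
  obtain ⟨K, hK0, hK⟩ := exists_enorm_sq_le_bergmanNormSq α
  obtain ⟨j, K', hK'0, hK'⟩ := exists_bergmanNormSq_kernelPow_le hα
  have hp : 0 < α + 2 := by linarith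
  -- The power of 2 comes from `φ w + conj a = 2 * Re a`; the `+ 1` keeps `L` positive when `C = 0`.
  set L : ℝ := 2 ^ (2 * (j + 1)) * (K * ((C : ℝ) ^ 2 * K') + 1) with hL
  have hL0 : 0 < L := by positivity
  refine ⟨(L ^ (α + 2)⁻¹)⁻¹, by positivity, fun w hw => ?_⟩
  have hw0 : 0 < w.re := hw
  set a := φ w with ha_def
  have ha : a ∈ rightHalfPlane := hφ.mapsTo hw
  have ha0 : 0 < a.re := ha
  set F := kernelPow (j + 1) a
  have hFmem : F ∈ bergmanSpace α := ⟨differentiableOn_kernelPow _ ha,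
    bergmanNorm_lt_top_iff.2 ((hK' a ha).trans_lt ENNReal.ofReal_lt_top)⟩
  have h1 : bergmanNormSq α (compOp φ F) ≤ ENNReal.ofReal ((C : ℝ) ^ 2) * bergmanNormSq α F := by
    have h2 := ENNReal.rpow_le_rpow (hC F hFmem) (zero_le_two (α := ℝ))
    rw [ENNReal.mul_rpow_of_nonneg _ _ zero_le_two, bergmanNorm, bergmanNorm, ← ENNReal.rpow_mul,
      ← ENNReal.rpow_mul] at h2
    norm_num at h2
    rwa [ENNReal.ofReal_pow C.coe_nonneg, ENNReal.ofReal_coe_nnreal]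
  have h3 := hK (compOp φ F) (hmaps F hFmem).1 w hw
  have hval : ‖compOp φ F w‖ₑ ^ 2 = ENNReal.ofReal (((2 * a.re) ^ (2 * (j + 1)))⁻¹) := by
    rw [← ofReal_norm, ← ENNReal.ofReal_pow (norm_nonneg _)]
    congr 1
    have : compOp φ F w = (((2 * a.re : ℝ) : ℂ) ^ (j + 1))⁻¹ := by
      rw [← Complex.add_conj]
      rfl
    rw [this, norm_inv, norm_pow, Complex.norm_real, Real.norm_of_nonneg (by positivity), inv_pow,
      ← pow_mul, mul_comm (j + 1)]
  have h4 : w.re ^ (α + 2) * ((2 * a.re) ^ (2 * (j + 1)))⁻¹ ≤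
      K * ((C : ℝ) ^ 2 * (K' * a.re ^ (α - 2 * j))) := by
    rw [hval, ← ENNReal.ofReal_mul (by positivity)] at h3
    refine (ENNReal.ofReal_le_ofReal_iff (by positivity)).1 (h3.trans ?_)
    rw [ENNReal.ofReal_mul hK0.le, ENNReal.ofReal_mul (by positivity)]
    gcongr
    refine h1.trans ?_
    gcongr
    exact hK' a ha
  have h5 : w.re ^ (α + 2) ≤ L * a.re ^ (α + 2) := by
    rw [← div_eq_mul_inv, div_le_iff₀ (by positivity)] at h4
    -- The power `j` cancels, so the final estimate has exponent `α + 2` on both sides.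
    have h6 : a.re ^ (α - 2 * j) * a.re ^ (2 * (j + 1)) = a.re ^ (α + 2) := by
      rw [← Real.rpow_natCast, ← Real.rpow_add ha0]
      congr 1
      push_cast
      ring
    calc w.re ^ (α + 2) ≤ _ := h4
      _ = 2 ^ (2 * (j + 1)) * (K * ((C : ℝ) ^ 2 * K')) *
          (a.re ^ (α - 2 * j) * a.re ^ (2 * (j + 1))) := by
          rw [mul_pow]
          ring
      _ ≤ L * a.re ^ (α + 2) := by
          rw [h6, hL]
          gcongr
          linarith
  have h7 : w.re ≤ L ^ (α + 2)⁻¹ * a.re := by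
    rw [← Real.rpow_le_rpow_iff hw0.le (by positivity) hp, Real.mul_rpow (by positivity) ha0.le,
      Real.rpow_inv_rpow hL0.le hp.ne']
    exact h5
  rw [inv_mul_le_iff₀ (by positivity)]
  exact h7

theorem mainTheorem10 (α : ℝ) (hα : -1 ≤ α) (φ : ℂ → ℂ) (hφ : IsAnalyticSelfMap φ) :
    CompOpBounded α φ ↔ HasFiniteAngularDerivAtInfty φ := by
  rw [hasFiniteAngularDerivAtInfty_iff hφ]
  exact ⟨exists_le_re_of_compOpBounded hα hφ,
    fun ⟨_, hc, hre⟩ => compOpBounded_of_le_re hα hφ hc hre⟩
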